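/- A \emph{$T$-round protocol} on a finite digraph $G$ is synchronous: each party (vertex) has an input; in each of the $T$ rounds it sends one bit to each out-neighbour, determined by its input and the bits it received in earlier rounds; at the end it computes an output from its input and all bits it received. A \emph{compiler} $C$ turns each protocol $\pi$ on $G$ into a simulation $C(\pi)$: a synchronous protocol with the same input and output sets, on a subgraph of $G$ and with any number of rounds, in which the parties may also use independent private randomness. An adversary, who knows all inputs, the simulation, and the entire history of communications up to and including the bits currently being sent (but not the parties' private randomness), may flip transmitted bits; she stays within the per-edge error rate $\rho$ if on each edge the fraction of the transmitted bits that are flipped is always at most $\rho$. The simulation fails if some party's output differs from its output in the noiseless execution of $\pi$ on the same inputs. The \emph{failure probability} of $C(\pi)$ in the presence of the per-edge error rate $\rho$ is the supremum, over all adversaries within that rate and all inputs, of the probability (over the private randomness) of failure. The \emph{signal diameter} of $G$ is the maximum finite directed distance between two vertices of $G$. \textbf{Theorem.} Let $C$ be a compiler and let $G$ be a finite digraph with signal diameter $D \ge 1$. Then for all sufficiently large $T$ there exists a $T$-round protocol $\pi$ on $G$ such that the failure probability of $C(\pi)$ in the presence of the per-edge error rate $\frac{1}{2D}$ is at least $\frac14$.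 -/

import Mathlib

open MeasureTheory Filter

noncomputable section

namespace SyncNet

variable {V : Type}

/-- `HasWalk G n u v`: there is a directed walk of length `n` from `u` to `v` in `G`. -/
def HasWalk (G : Digraph V) : ℕ → V → V → Prop
  | 0, u, v => u = v
  | n + 1, u, v => ∃ w, G.Adj u w ∧ HasWalk G n w v

/-- `v` is reachable from `u`, and the directed distance from `u` to `v` is `d`. -/
def IsDist (G : Digraph V) (u v : V) (d : ℕ) : Prop :=
  IsLeast {n | HasWalk G n u v} d

/-- `D` is the maximum finite directed distance between two vertices of `G`. -/
def IsSignalDiameter (G : Digraph V) (D : ℕ) : Prop :=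
  IsGreatest {d | ∃ u v, IsDist G u v d} D

/-- The directed edges of `G`. -/
abbrev Edge (G : Digraph V) : Type := {e : V × V // G.Adj e.1 e.2}

/-- The in-neighbours of `v`. -/
abbrev InNbr (G : Digraph V) (v : V) : Type := {u : V // G.Adj u v}

/-- The out-neighbours of `v`. -/
abbrev OutNbr (G : Digraph V) (v : V) : Type := {w : V // G.Adj v w}

/-- A deterministic `T`-round synchronous protocol on `G` in which party `v` has an input in `I v`
and an output in `O v`. In each round every party sends one bit to each of its out-neighbours; the
bits depend on its input and on the bits that it received in the earlier rounds. After the last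
round each party computes its output from its input and all the bits that it received. -/
structure Protocol (G : Digraph V) (T : ℕ) (I O : V → Type) where
  send : ∀ v, I v → ∀ t : Fin T, (Fin t → InNbr G v → Bool) → OutNbr G v → Bool
  output : ∀ v, I v → (Fin T → InNbr G v → Bool) → O v

/-- The behaviour of the channels in `T` rounds on `G`: the bits delivered on the edges in round `t`
are a function of the bits sent in the rounds up to and including `t` and of the bits delivered in
the rounds before `t`. -/
abbrev Channel (G : Digraph V) (T : ℕ) : Type :=
  ∀ t : Fin T, (Fin (t + 1) → Edge G → Bool) → (Fin t → Edge G → Bool) → Edge G → Bool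

/-- The channels that deliver every bit as it was sent. -/
def noiseless (G : Digraph V) (T : ℕ) : Channel G T :=
  fun t sent _ => sent (Fin.last t)

namespace Protocol

variable {G : Digraph V} {T : ℕ} {I O : V → Type}

/-- The bits that arrive at party `v`, given the bits delivered on all edges. -/
def view (v : V) {t : ℕ} (delivered : Fin t → Edge G → Bool) : Fin t → InNbr G v → Bool :=
  fun s u => delivered s ⟨(u.1, v), u.2⟩

/-- The first `t` rounds of the execution of `P` on the inputs `x` over the channels `N`: the bits
sent (first component) and the bits delivered (second component) on each edge in each round. -/
def exec (P : Protocol G T I O) (x : ∀ v, I v) (N : Channel G T) :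
    (t : ℕ) → t ≤ T → (Fin t → Edge G → Bool) × (Fin t → Edge G → Bool)
  | 0, _ => (Fin.elim0, Fin.elim0)
  | t + 1, h =>
    let past := P.exec x N t (Nat.le_of_succ_le h)
    let sent : Fin (t + 1) → Edge G → Bool :=
      Fin.snoc (α := fun _ => Edge G → Bool) past.1 fun e =>
        P.send e.1.1 (x e.1.1) ⟨t, h⟩ (view e.1.1 past.2) ⟨e.1.2, e.2⟩
    (sent, Fin.snoc (α := fun _ => Edge G → Bool) past.2 (N ⟨t, h⟩ sent past.2))

/-- The bits sent in all the rounds of the execution. -/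
def sent (P : Protocol G T I O) (x : ∀ v, I v) (N : Channel G T) : Fin T → Edge G → Bool :=
  (P.exec x N T le_rfl).1

/-- The bits delivered in all the rounds of the execution. -/
def delivered (P : Protocol G T I O) (x : ∀ v, I v) (N : Channel G T) : Fin T → Edge G → Bool :=
  (P.exec x N T le_rfl).2

/-- The outputs of the parties in the execution of `P` on the inputs `x` over the channels `N`. -/
def result (P : Protocol G T I O) (x : ∀ v, I v) (N : Channel G T) (v : V) : O v :=
  P.output v (x v) (view v (P.delivered x N))

/-- The number of bits transmitted on the edge `e` that are flipped by the channel. -/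
def flips (P : Protocol G T I O) (x : ∀ v, I v) (N : Channel G T) (e : Edge G) : ℕ :=
  (Finset.univ.filter fun t : Fin T => P.sent x N t e ≠ P.delivered x N t e).card

end Protocol

/-- A simulation, on `G`, of protocols with inputs in `I` and outputs in `O`: a protocol with these
inputs and outputs that runs on a subgraph of `G` for any number of rounds, and in which each party
`v` has private randomness, a point of `Coin v` drawn from the law `coinLaw v` independently of
the randomness of the other parties. -/
structure Simulation (G : Digraph V) (I O : V → Type) where
  graph : Digraph V
  graph_le : graph ≤ G
  rounds : ℕ
  Coin : V → Type
  [coinSpace : ∀ v, MeasurableSpace (Coin v)]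
  coinLaw : ∀ v, Measure (Coin v)
  [coinLaw_prob : ∀ v, IsProbabilityMeasure (coinLaw v)]
  protocol : Protocol graph rounds (fun v => I v × Coin v) O
  measurable_send : ∀ v (x : I v) t received w,
    Measurable fun c : Coin v => protocol.send v (x, c) t received w
  measurable_output : ∀ v (x : I v) received y,
    MeasurableSet {c : Coin v | protocol.output v (x, c) received = y}

attribute [instance] Simulation.coinSpace Simulation.coinLaw_prob

namespace Simulation

variable {G : Digraph V} {I O : V → Type}

/-- An adversary against the simulation `S`. It knows the inputs of all the parties and the history
of communications up to the present, but not the private randomness of the parties. -/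
abbrev Adversary (S : Simulation G I O) : Type :=
  (∀ v, I v) → Channel S.graph S.rounds

/-- The adversary `A` stays within the per-edge error rate `ρ`: whatever the inputs and the private
randomness, on each edge the fraction of the transmitted bits that are flipped is at most `ρ`. -/
def Adversary.WithinRate {S : Simulation G I O} (A : S.Adversary) (ρ : ℝ) : Prop :=
  ∀ (x : ∀ v, I v) (c : ∀ v, S.Coin v) (e : Edge S.graph),
    (S.protocol.flips (fun v => (x v, c v)) (A x) e : ℝ) ≤ ρ * S.rounds

variable [Fintype V]

/-- The probability, over the private randomness of the parties, that on the inputs `x` and against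
the adversary `A` some party's output in `S` is not its output in the noiseless execution
of `P`. -/
def failure {T : ℕ} (S : Simulation G I O) (P : Protocol G T I O) (A : S.Adversary)
    (x : ∀ v, I v) : ENNReal :=
  Measure.pi S.coinLaw
    {c | ∃ v, S.protocol.result (fun w => (x w, c w)) (A x) v ≠ P.result x (noiseless G T) v}

/-- The failure probability of `S`, as a simulation of `P`, in the presence of the per-edge error
rate `ρ`: the worst case over all adversaries within this rate and all inputs. -/
def failureProbability {T : ℕ} (S : Simulation G I O) (P : Protocol G T I O) (ρ : ℝ) : ENNReal :=
  ⨆ (A : S.Adversary) (_ : A.WithinRate ρ) (x : ∀ v, I v), S.failure P A x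

end Simulation

/-- A compiler turns every protocol on every finite digraph into a simulation. -/
abbrev Compiler : Type 1 :=
  ∀ {V : Type} [Fintype V] (G : Digraph V) (T : ℕ) (I O : V → Type),
    Protocol G T I O → Simulation G I O

end SyncNet

end

noncomputable section

namespace SyncNet

/-! Let `v` be at distance `D` from `u`, and let `v` have to learn a long random string held by `u`.
Of the `R` rounds of the simulation, leave the first `r = R % (2 * D)` alone and cut the rest into
`D` blocks of `2 * f` rounds. A party `a` at distance `l` from `u` (capped at `D`) gets the time `τ
a = r + 2 * f * l`. At that time the adversary resamples the input and randomness of `a`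
conditionally on its history, and from then on she imagines a second execution that uses the
resampled data.

An edge climbs at most one layer, so on an edge from `a` to `b` there are at most `2 * f` rounds
between `τ a` and `τ b`. In one half of them she delivers the real bit, in the other half the
imaginary one, which costs at most `f ≤ R / (2 * D)` flips. The flag `j` says which half is which.
Exchanging the two executions and negating `j` leaves what each `a` receives before `τ a` unchanged,
hence the whole view of `v`, as `τ v = R` (`IsAttacked.swap`). The exchange preserves probability,
since a sample from the posterior is exchangeable with the original (`weight_swap`).

So `v` gives the same output in both executions and errs in one of them, unless the real and the
imaginary string of `u` agree. This is unlikely, because fewer than `2 * D` rounds reveal boundedly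
many bits (`sum_eq_le`). Hence the two failure probabilities add up to almost one
(`one_sub_le_sum`). The adversary's own randomness, a table of resampled values drawn in advance, is
removed by averaging. Private coins are replaced by the finitely many deterministic strategies they
induce, so all probabilities are finite sums. -/

/-- The bits on the edges of `Q` at all times. -/
abbrev Trace {V : Type} (Q : Digraph V) : Type := ℕ → Edge Q → Bool

/-! ### Executions as traces satisfying a recursion in time -/

section Executions

variable {V : Type} {Q : Digraph V} {R : ℕ} {Ω O : V → Type}

/-- A trace that agrees with `b` in the first `t` rounds and is `false` afterwards. -/
def extend {t : ℕ} (b : Fin t → Edge Q → Bool) : Trace Q :=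
  fun s e => if h : s < t then b ⟨s, h⟩ e else false

theorem extend_of_lt {t : ℕ} (b : Fin t → Edge Q → Bool) {s : ℕ} (h : s < t) (e : Edge Q) :
    extend b s e = b ⟨s, h⟩ e := by
  simp [extend, h]

namespace Protocol

variable (P : Protocol Q R Ω O)

/-- The bit that party `a` with input `ω` sends to `w` in round `t`, given the trace of delivered
bits. -/
def bit (a : V) (ω : Ω a) (t : ℕ) (δ : Trace Q) (w : OutNbr Q a) : Bool :=
  if h : t < R then P.send a ω ⟨t, h⟩ (view a (fun s : Fin t => δ s)) w else false

theorem bit_congr {a : V} (ω : Ω a) {t : ℕ} {δ δ' : Trace Q} (w : OutNbr Q a)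
    (h : ∀ s < t, ∀ e : Edge Q, e.1.2 = a → δ s e = δ' s e) :
    P.bit a ω t δ w = P.bit a ω t δ' w := by
  unfold bit
  split_ifs with ht
  · have : view a (fun s : Fin t => δ s) = view a (fun s : Fin t => δ' s) := by
      funext s i
      exact h s s.2 _ rfl
    rw [this]
  · rfl

theorem exec_sent_eq (x : ∀ a, Ω a) (N : Channel Q R) {t : ℕ} (h : t ≤ R) {i : ℕ} (hi : i < t) :
    (P.exec x N t h).1 ⟨i, hi⟩ = (P.exec x N (i + 1) (hi.trans_le h)).1 (Fin.last i) := by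
  induction t with
  | zero => omega
  | succ t ih =>
    rcases Nat.lt_succ_iff_lt_or_eq.mp hi with hi' | rfl
    · rw [← ih (Nat.le_of_succ_le h) hi']
      exact Fin.snoc_castSucc (α := fun _ => Edge Q → Bool) _ _ ⟨i, hi'⟩
    · rfl

theorem exec_delivered_eq (x : ∀ a, Ω a) (N : Channel Q R) {t : ℕ} (h : t ≤ R) {i : ℕ}
    (hi : i < t) :
    (P.exec x N t h).2 ⟨i, hi⟩ = (P.exec x N (i + 1) (hi.trans_le h)).2 (Fin.last i) := by
  induction t with
  | zero => omega
  | succ t ih =>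
    rcases Nat.lt_succ_iff_lt_or_eq.mp hi with hi' | rfl
    · rw [← ih (Nat.le_of_succ_le h) hi']
      exact Fin.snoc_castSucc (α := fun _ => Edge Q → Bool) _ _ ⟨i, hi'⟩
    · rfl

/-- The trace of the bits sent in the execution. -/
def sentTrace (x : ∀ a, Ω a) (N : Channel Q R) : Trace Q := extend (P.sent x N)

/-- The trace of the bits delivered in the execution. -/
def deliveredTrace (x : ∀ a, Ω a) (N : Channel Q R) : Trace Q := extend (P.delivered x N)

theorem exec_fst_eq (x : ∀ a, Ω a) (N : Channel Q R) {t : ℕ} (h : t ≤ R) :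
    (P.exec x N t h).1 = fun s : Fin t => P.sentTrace x N s := by
  funext s e
  rw [sentTrace, extend_of_lt _ (s.2.trans_le h), sent,
    exec_sent_eq P x N le_rfl, ← exec_sent_eq P x N h s.2]

theorem exec_snd_eq (x : ∀ a, Ω a) (N : Channel Q R) {t : ℕ} (h : t ≤ R) :
    (P.exec x N t h).2 = fun s : Fin t => P.deliveredTrace x N s := by
  funext s e
  rw [deliveredTrace, extend_of_lt _ (s.2.trans_le h), delivered,
    exec_delivered_eq P x N le_rfl, ← exec_delivered_eq P x N h s.2]

theorem sentTrace_eq_bit (x : ∀ a, Ω a) (N : Channel Q R) {t : ℕ} (h : t < R) (e : Edge Q) :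
    P.sentTrace x N t e
      = P.bit e.1.1 (x e.1.1) t (P.deliveredTrace x N) ⟨e.1.2, e.2⟩ := by
  have h1 := congrFun (congrFun (P.exec_fst_eq x N (t := t + 1) h) (Fin.last t)) e
  rw [Fin.val_last] at h1
  rw [← h1]
  simp only [exec, Fin.snoc_last, bit, dif_pos h]
  rw [exec_snd_eq]

theorem deliveredTrace_eq (x : ∀ a, Ω a) (N : Channel Q R) {t : ℕ} (h : t < R) (e : Edge Q) :
    P.deliveredTrace x N t e
      = N ⟨t, h⟩ (fun s => P.sentTrace x N s) (fun s => P.deliveredTrace x N s) e := by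
  have h1 := congrFun (congrFun (P.exec_snd_eq x N (t := t + 1) h) (Fin.last t)) e
  rw [Fin.val_last] at h1
  have h2 := P.exec_fst_eq x N (t := t + 1) h
  rw [← h1]
  simp only [exec, Fin.snoc_last] at h2 ⊢
  rw [h2, exec_snd_eq]

theorem result_eq (x : ∀ a, Ω a) (N : Channel Q R) (v : V) :
    P.result x N v = P.output v (x v) (view v fun s : Fin R => P.deliveredTrace x N s) := by
  rw [result, delivered, exec_snd_eq]

end Protocol

end Executions

/-! ### The imaginary execution and the attack -/

section FakeWorld

open scoped Classical

variable {V : Type} {Q : Digraph V} {R : ℕ} {Ω O : V → Type} [∀ a, Fintype (Ω a)]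

/-- A choice of an input for each party and each set of inputs of that party. -/
abbrev Table (Ω : V → Type) : Type := ∀ i : (Σ a, Finset (Ω a)), Ω i.1

namespace Protocol

variable (P : Protocol Q R Ω O) (τ : V → ℕ) (sel : ℕ → Bool) (σ : Table Ω)

/-- The inputs of `a` that are consistent with the bits it sent and received before `τ a`. -/
def consistent (s δ : Trace Q) (a : V) : Finset (Ω a) :=
  Finset.univ.filter fun ω =>
    ∀ t < τ a, ∀ w : OutNbr Q a, P.bit a ω t δ w = s t ⟨(a, w.1), w.2⟩

variable {τ} in
theorem mem_consistent {s δ : Trace Q} {a : V} {ω : Ω a} :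
    ω ∈ P.consistent τ s δ a ↔
      ∀ t < τ a, ∀ w : OutNbr Q a, P.bit a ω t δ w = s t ⟨(a, w.1), w.2⟩ := by
  simp [consistent]

/-- The last bits that count are those sent in round `τ a - 1`, and they depend on deliveries
strictly before that round; hence `t + 1 < τ a` for `δ`. -/
theorem consistent_congr {s δ s' δ' : Trace Q} {a : V}
    (hs : ∀ t < τ a, ∀ e : Edge Q, e.1.1 = a → s t e = s' t e)
    (hδ : ∀ t, t + 1 < τ a → ∀ e : Edge Q, e.1.2 = a → δ t e = δ' t e) :
    P.consistent τ s δ a = P.consistent τ s' δ' a := by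
  ext ω
  rw [mem_consistent, mem_consistent]
  refine forall_congr' fun t => forall_congr' fun ht => forall_congr' fun w => ?_
  rw [hs t ht _ rfl, P.bit_congr ω w fun q hq e he => hδ q (by omega) e he]

/-- The bits sent in an imaginary execution, in which every party `a` has from time `τ a` on the
input that `σ` chooses among those consistent with its history. -/
def fakeSent (s δ : Trace Q) (t : ℕ) (e : Edge Q) : Bool :=
  if t < τ e.1.1 then s t e
  else P.bit e.1.1 (σ ⟨e.1.1, P.consistent τ s δ e.1.1⟩) t
    -- The guard only makes the recursion well-founded: a bit sent in round `t` does not depend on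
    -- deliveries from round `t` on.
    (fun q e' => if _h : q < t then
      (if q < τ e'.1.2 then δ q e' else fakeSent s δ q e') else false) ⟨e.1.2, e.2⟩
termination_by t

/-- The bits delivered in the imaginary execution. -/
def fakeDelivered (s δ : Trace Q) : Trace Q :=
  fun t e => if t < τ e.1.2 then δ t e else P.fakeSent τ σ s δ t e

theorem fakeSent_eq (s δ : Trace Q) (t : ℕ) (e : Edge Q) :
    P.fakeSent τ σ s δ t e =
      if t < τ e.1.1 then s t e
      else P.bit e.1.1 (σ ⟨e.1.1, P.consistent τ s δ e.1.1⟩) t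
        (P.fakeDelivered τ σ s δ) ⟨e.1.2, e.2⟩ := by
  rw [fakeSent]
  split_ifs with h
  · rfl
  · refine P.bit_congr _ _ fun q hq e' _ => ?_
    simp [hq, fakeDelivered]

/-- Causality: the adversary can compute the imaginary bits of round `t` from what a channel may see
in that round. -/
theorem fakeSent_congr {s δ s' δ' : Trace Q} {t : ℕ}
    (hs : ∀ q ≤ t, ∀ e, s q e = s' q e) (hδ : ∀ q < t, ∀ e, δ q e = δ' q e) (e : Edge Q) :
    P.fakeSent τ σ s δ t e = P.fakeSent τ σ s' δ' t e := by
  induction t using Nat.strong_induction_on generalizing e with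
  | _ t ih =>
    rw [fakeSent_eq, fakeSent_eq]
    split_ifs with h
    · exact hs t le_rfl e
    · rw [P.consistent_congr τ (fun q hq e _ => hs q (by omega) e)
        (fun q hq e _ => hδ q (by omega) e)]
      refine P.bit_congr _ _ fun q hq e' _ => ?_
      simp only [fakeDelivered]
      rw [hδ q hq, ih q hq (fun p hp => hs p (by omega)) (fun p hp => hδ p (by omega))]

/-- The adversary who, on the edges from a party `a` to a party `b`, in the rounds `t` with
`τ a ≤ t < τ b` and `sel t ≠ j`, delivers the bits sent in the imaginary execution. -/
def attack (j : Bool) : Channel Q R := fun t s δ e =>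
  if τ e.1.1 ≤ t ∧ t < τ e.1.2 ∧ sel t ≠ j then P.fakeSent τ σ (extend s) (extend δ) t e
  else s (Fin.last t) e

theorem attack_apply (j : Bool) (s δ : Trace Q) {t : ℕ} (h : t < R) (e : Edge Q) :
    P.attack τ sel σ j ⟨t, h⟩ (fun q => s q) (fun q => δ q) e =
      if τ e.1.1 ≤ t ∧ t < τ e.1.2 ∧ sel t ≠ j then P.fakeSent τ σ s δ t e else s t e := by
  simp only [attack, Fin.val_last]
  congr 1
  exact P.fakeSent_congr τ σ (fun q hq e => extend_of_lt _ (Nat.lt_succ_of_le hq) e)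
    (fun q hq e => extend_of_lt _ hq e) e

/-- The pair `(s, δ)` of traces is the execution on `x` against the attack. -/
structure IsAttacked (x : ∀ a, Ω a) (j : Bool) (s δ : Trace Q) : Prop where
  sent_eq : ∀ t < R, ∀ e : Edge Q, s t e = P.bit e.1.1 (x e.1.1) t δ ⟨e.1.2, e.2⟩
  delivered_eq : ∀ t < R, ∀ e : Edge Q, δ t e =
    if τ e.1.1 ≤ t ∧ t < τ e.1.2 ∧ sel t ≠ j then P.fakeSent τ σ s δ t e else s t e

theorem isAttacked (x : ∀ a, Ω a) (j : Bool) :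
    P.IsAttacked τ sel σ x j (P.sentTrace x (P.attack τ sel σ j))
      (P.deliveredTrace x (P.attack τ sel σ j)) where
  sent_eq t ht e := P.sentTrace_eq_bit x _ ht e
  delivered_eq t ht e := by
    rw [P.deliveredTrace_eq x _ ht e, attack_apply]

variable {P τ sel σ}

theorem IsAttacked.unique {x : ∀ a, Ω a} {j : Bool} {s δ s' δ' : Trace Q}
    (h : P.IsAttacked τ sel σ x j s δ) (h' : P.IsAttacked τ sel σ x j s' δ') {t : ℕ} (ht : t < R) :
    (∀ e, s t e = s' t e) ∧ ∀ e, δ t e = δ' t e := by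
  induction t using Nat.strong_induction_on with
  | _ t ih =>
    have hs : ∀ e, s t e = s' t e := fun e => by
      rw [h.sent_eq t ht, h'.sent_eq t ht]
      exact P.bit_congr _ _ fun q hq e' _ => (ih q hq (hq.trans ht)).2 e'
    refine ⟨hs, fun e => ?_⟩
    rw [h.delivered_eq t ht, h'.delivered_eq t ht, hs e]
    congr 1
    refine P.fakeSent_congr τ σ (fun q hq e => ?_) (fun q hq e => (ih q hq (hq.trans ht)).2 e) e
    rcases hq.lt_or_eq with hq | rfl
    · exact (ih q hq (hq.trans ht)).1 e
    · exact hs e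

theorem IsAttacked.mem_consistent {x : ∀ a, Ω a} {j : Bool} {s δ : Trace Q}
    (h : P.IsAttacked τ sel σ x j s δ) (a : V) (ha : τ a ≤ R) :
    x a ∈ P.consistent τ s δ a :=
  P.mem_consistent.mpr fun t ht w => (h.sent_eq t (ht.trans_le ha) ⟨(a, w.1), w.2⟩).symm

/-- The inputs in the imaginary execution. Party `v` has its actual input. -/
def swapInput (v : V) (K : ∀ a, Finset (Ω a)) (σ : Table Ω) (x : ∀ a, Ω a) (a : V) : Ω a :=
  if a = v then x a else σ ⟨a, K a⟩

/-- The table that makes the adversary imagine the actual execution in the imaginary one. -/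
def swapTable (v : V) (K : ∀ a, Finset (Ω a)) (σ : Table Ω) (x : ∀ a, Ω a) : Table Ω :=
  fun i => if i.1 ≠ v ∧ i.2 = K i.1 then x i.1 else σ i

omit [∀ a, Fintype (Ω a)] in
theorem swapInput_swap (v : V) (K : ∀ a, Finset (Ω a)) (σ : Table Ω) (x : ∀ a, Ω a) :
    swapInput v K (swapTable v K σ x) (swapInput v K σ x) = x := by
  funext a
  by_cases h : a = v <;> simp [swapInput, swapTable, h]

omit [∀ a, Fintype (Ω a)] in
theorem swapTable_swap (v : V) (K : ∀ a, Finset (Ω a)) (σ : Table Ω) (x : ∀ a, Ω a) :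
    swapTable v K (swapTable v K σ x) (swapInput v K σ x) = σ := by
  funext ⟨a, L⟩
  by_cases h : a = v
  · simp [swapTable, h]
  · by_cases hL : L = K a
    · subst hL
      simp [swapInput, swapTable, h]
    · simp [swapTable, hL]

/-- The actual and the imaginary execution can be exchanged. -/
theorem IsAttacked.swap {x : ∀ a, Ω a} {j : Bool} {s δ : Trace Q} {v : V} (hτ : ∀ a, τ a ≤ R)
    (hv : τ v = R)
    (h : P.IsAttacked τ sel σ x j s δ)
    (hσ : ∀ a, σ ⟨a, P.consistent τ s δ a⟩ ∈ P.consistent τ s δ a) :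
    let K := P.consistent τ s δ
    let s' := P.fakeSent τ σ s δ
    let δ' := P.fakeDelivered τ σ s δ
    P.IsAttacked τ sel (swapTable v K σ x) (swapInput v K σ x) (!j) s' δ' ∧
      P.consistent τ s' δ' = K := by
  intro K s' δ'
  have hs'1 : ∀ t (e : Edge Q), t < τ e.1.1 → s' t e = s t e := fun t e ht => by
    simp only [s', P.fakeSent_eq τ σ s δ t e, if_pos ht]
  have hδ'1 : ∀ t (e : Edge Q), t < τ e.1.2 → δ' t e = δ t e := fun t e ht => by
    simp only [δ', fakeDelivered, if_pos ht]
  have hδ'2 : ∀ t (e : Edge Q), ¬ t < τ e.1.2 → δ' t e = s' t e := fun t e ht => by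
    simp only [δ', fakeDelivered, if_neg ht, s']
  have hx' : ∀ a, swapInput v K σ x a ∈ K a := fun a => by
    unfold swapInput
    split_ifs
    · exact h.mem_consistent a (hτ a)
    · exact hσ a
  have hK : P.consistent τ s' δ' = K := by
    funext a
    refine P.consistent_congr τ (fun t ht e he => hs'1 t e (by rwa [he]))
      (fun t ht e he => hδ'1 t e (by rw [he]; omega))
  have hsent : ∀ t < R, ∀ e : Edge Q,
      s' t e = P.bit e.1.1 (swapInput v K σ x e.1.1) t δ' ⟨e.1.2, e.2⟩ := fun t ht e => by
    by_cases hlt : t < τ e.1.1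
    · rw [hs'1 t e hlt, ← P.mem_consistent.mp (hx' e.1.1) t hlt ⟨e.1.2, e.2⟩]
      exact P.bit_congr _ _ fun q hq e' he' => (hδ'1 q e' (by rw [he']; omega)).symm
    -- The sender is not `v`, because `τ v = R` exceeds `t`.
    · have : swapInput v K σ x e.1.1 = σ ⟨e.1.1, K e.1.1⟩ := if_neg (by rintro rfl; omega)
      rw [this]
      exact (P.fakeSent_eq τ σ s δ t e).trans (if_neg hlt)
  -- Seen from the imaginary execution, with the swapped table, the imagined execution is the real
  -- one.
  have hback : ∀ t < R, ∀ e : Edge Q,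
      P.fakeSent τ (swapTable v K σ x) s' δ' t e = s t e := by
    intro t
    induction t using Nat.strong_induction_on with
    | _ t ih =>
      intro ht e
      rw [P.fakeSent_eq]
      split_ifs with hlt
      · exact hs'1 t e hlt
      · have : swapTable v K σ x ⟨e.1.1, P.consistent τ s' δ' e.1.1⟩ = x e.1.1 :=
          if_pos ⟨fun h0 => by dsimp only at h0; rw [h0] at hlt; omega, by rw [hK]⟩
        rw [this, h.sent_eq t ht e]
        refine P.bit_congr _ _ fun q hq e' _ => ?_
        unfold fakeDelivered
        split_ifs with hq'
        · exact hδ'1 q e' hq'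
        · rw [ih q hq (hq.trans ht), h.delivered_eq q (hq.trans ht), if_neg (by tauto)]
  refine ⟨⟨hsent, fun t ht e => ?_⟩, hK⟩
  rw [hback t ht e]
  by_cases h2 : t < τ e.1.2
  · rw [hδ'1 t e h2, h.delivered_eq t ht e]
    by_cases h1 : τ e.1.1 ≤ t
    · by_cases h3 : sel t = j
      · simp [h1, h2, h3]
      · have h3' : sel t = !j := by
          revert h3; cases sel t <;> cases j <;> simp
        simp [h1, h2, h3', s']
    · simp [h1, hs'1 t e (by omega)]
  · rw [hδ'2 t e h2, if_neg (by tauto)]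

end Protocol

end FakeWorld

/-! ### Finite product distributions and conditioning -/

section Weights

open scoped Classical

theorem sum_prod_mul_apply {ι : Type} [Fintype ι] [DecidableEq ι] {β : ι → Type} [∀ i, Fintype (β i)]
    (p : ∀ i, β i → ℝ) (hp : ∀ i, ∑ b, p i b = 1) (i : ι) (h : β i → ℝ) :
    ∑ x : ∀ i, β i, (∏ k, p k (x k)) * h (x i) = ∑ b, p i b * h b := by
  have h1 : ∀ x : ∀ i, β i, (∏ k, p k (x k)) * h (x i)
      = ∏ k, Function.update p i (fun b => p i b * h b) k (x k) := fun x => by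
    rw [← Finset.mul_prod_erase _ _ (Finset.mem_univ i),
      ← Finset.mul_prod_erase (a := i) _ (fun k => Function.update p i _ k (x k))
        (Finset.mem_univ i)]
    have h2 : ∏ k ∈ Finset.univ.erase i, Function.update p i (fun b => p i b * h b) k (x k)
        = ∏ k ∈ Finset.univ.erase i, p k (x k) :=
      Finset.prod_congr rfl fun k hk => by
        rw [Function.update_of_ne (Finset.ne_of_mem_erase hk)]
    rw [Function.update_self, h2]
    ring
  simp_rw [h1]
  have h2 := Fintype.prod_sum (fun k b => Function.update p i (fun b => p i b * h b) k b)
  rw [← h2, ← Finset.mul_prod_erase _ _ (Finset.mem_univ i), Function.update_self,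
    Finset.prod_eq_one, mul_one]
  intro k hk
  rw [Function.update_of_ne (Finset.ne_of_mem_erase hk), hp]

/-- The weight of `ω` conditional on `K`, or just its weight if that of `K` is zero. -/
def condWeight {β : Type} (m : β → ℝ) (K : Finset β) (ω : β) : ℝ :=
  if ∑ b ∈ K, m b = 0 then m ω else if ω ∈ K then m ω / ∑ b ∈ K, m b else 0

section

variable {β : Type} {m : β → ℝ}

/-- Both sides are `m ω * m ω'` divided by the weight of `K` (undivided if that is zero): the
original and its resampled copy are exchangeable. -/
theorem mul_condWeight_comm {K : Finset β} {ω ω' : β} (h : ω ∈ K) (h' : ω' ∈ K) :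
    m ω * condWeight m K ω' = m ω' * condWeight m K ω := by
  unfold condWeight
  split_ifs <;> ring

theorem sum_condWeight [Fintype β] (h1 : ∑ b, m b = 1) (K : Finset β) :
    ∑ b, condWeight m K b = 1 := by
  unfold condWeight
  split_ifs with h
  · exact h1
  · rw [← Finset.sum_filter, Finset.filter_mem_eq_inter, Finset.univ_inter, ← Finset.sum_div,
      div_self h]

variable (hm : ∀ b, 0 ≤ m b)
include hm

theorem condWeight_nonneg (K : Finset β) (ω : β) : 0 ≤ condWeight m K ω := by
  unfold condWeight
  have := Finset.sum_nonneg fun b (_ : b ∈ K) => hm b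
  split_ifs
  · exact hm ω
  · exact div_nonneg (hm ω) this
  · exact le_rfl

theorem mem_of_condWeight_ne_zero {K : Finset β} {ω ω' : β} (hω : ω ∈ K) (h : m ω ≠ 0)
    (h' : condWeight m K ω' ≠ 0) : ω' ∈ K := by
  unfold condWeight at h'
  have : ∑ b ∈ K, m b ≠ 0 := fun h0 =>
    h ((Finset.sum_eq_zero_iff_of_nonneg fun b _ => hm b).mp h0 ω hω)
  by_contra hK
  simp [this, hK] at h'

/-- Conditioning on `K` raises the probability of a value of `X` to at most `ε` over the weight of
`K`; the event that `b` lies in `K` gives this factor back. -/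
theorem sum_mul_sum_condWeight_le [Fintype β] {Z : Type} (X : β → Z) {ε : ℝ} (hε : 0 ≤ ε)
    (hX : ∀ z, ∑ b, m b * (if X b = z then 1 else 0) ≤ ε) (K : Finset β) :
    ∑ b, m b * ((if b ∈ K then 1 else 0) *
      ∑ b', condWeight m K b' * (if X b' = X b then 1 else 0)) ≤ ε := by
  by_cases h : ∑ b ∈ K, m b = 0
  · rw [Finset.sum_eq_zero]
    · exact hε
    intro b _
    split_ifs with hb
    · rw [(Finset.sum_eq_zero_iff_of_nonneg fun b _ => hm b).mp h b hb, zero_mul]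
    · simp
  · have hpos : 0 < ∑ b ∈ K, m b :=
      lt_of_le_of_ne (Finset.sum_nonneg fun b _ => hm b) (Ne.symm h)
    have h1 : ∀ z, ∑ b', condWeight m K b' * (if X b' = z then 1 else 0)
        ≤ ε / ∑ b ∈ K, m b := fun z => by
      refine le_trans ?_ (div_le_div_of_nonneg_right (hX z) hpos.le)
      rw [Finset.sum_div]
      refine Finset.sum_le_sum fun b _ => ?_
      rw [mul_div_right_comm]
      refine mul_le_mul_of_nonneg_right ?_ (by split_ifs <;> norm_num)
      rw [condWeight, if_neg h]
      split_ifs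
      · exact le_rfl
      · exact div_nonneg (hm b) hpos.le
    calc _ ≤ ∑ b, m b * ((if b ∈ K then 1 else 0) * (ε / ∑ b ∈ K, m b)) := by
          refine Finset.sum_le_sum fun b _ => mul_le_mul_of_nonneg_left ?_ (hm b)
          exact mul_le_mul_of_nonneg_left (h1 _) (by split_ifs <;> norm_num)
      _ = (∑ b ∈ K, m b) * (ε / ∑ b ∈ K, m b) := by
          simp only [ite_mul, one_mul, zero_mul, mul_ite, mul_zero]
          rw [← Finset.sum_filter, Finset.filter_mem_eq_inter, Finset.univ_inter, Finset.sum_mul]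
      _ = ε := mul_div_cancel₀ _ h

end

end Weights

/-! ### The exchange as an involution -/

section Swap

open scoped Classical

variable {V : Type} {Q : Digraph V} {R : ℕ} {Ω O : V → Type} [∀ a, Fintype (Ω a)]

namespace Protocol

variable (P : Protocol Q R Ω O) (τ : V → ℕ) (sel : ℕ → Bool)

/-- The histories of the parties in the execution on the inputs `p.1` against the attack with the
table `p.2`. -/
def histories (j : Bool) (p : (∀ a, Ω a) × Table Ω) (a : V) : Finset (Ω a) :=
  P.consistent τ (P.sentTrace p.1 (P.attack τ sel p.2 j))
    (P.deliveredTrace p.1 (P.attack τ sel p.2 j)) a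

/-- The exchange of the actual and the imaginary execution. -/
def swap (v : V) (j : Bool) (p : (∀ a, Ω a) × Table Ω) : (∀ a, Ω a) × Table Ω :=
  (swapInput v (P.histories τ sel j p) p.2 p.1, swapTable v (P.histories τ sel j p) p.2 p.1)

-- No edge is attacked before round `r`, so sent and delivered bits coincide there and one string
-- `y` encodes the history of `u`.
variable {τ sel} in
theorem exists_histories_eq {u : V} {r : ℕ} (hr : ∀ a, r ≤ τ a) (hu : τ u = r) (hR : r ≤ R) (j : Bool)
    (p : (∀ a, Ω a) × Table Ω) :
    ∃ y : Fin r → Edge Q → Bool,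
      P.histories τ sel j p u = P.consistent τ (extend y) (extend y) u := by
  have h := P.isAttacked τ sel p.2 p.1 j
  refine ⟨fun t e => P.sentTrace p.1 (P.attack τ sel p.2 j) t e,
    P.consistent_congr τ (fun t ht e _ => ?_) (fun t ht e _ => ?_)⟩
  · rw [extend_of_lt _ (by omega)]
  · rw [extend_of_lt _ (by omega), h.delivered_eq t (by omega), if_neg]
    have := hr e.1.1
    omega

variable {τ sel} {v : V} (hτ : ∀ a, τ a ≤ R) (hv : τ v = R) {j : Bool}
  {p : (∀ a, Ω a) × Table Ω}
  (hp : ∀ a, p.2 ⟨a, P.histories τ sel j p a⟩ ∈ P.histories τ sel j p a)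
include hτ hv hp

theorem histories_swap :
    P.histories τ sel (!j) (P.swap τ sel v j p) = P.histories τ sel j p := by
  obtain ⟨h1, h2⟩ := (P.isAttacked τ sel p.2 p.1 j).swap hτ hv hp
  have h3 := P.isAttacked τ sel (P.swap τ sel v j p).2 (P.swap τ sel v j p).1 (!j)
  refine Eq.trans ?_ h2
  funext a
  have := hτ a
  exact P.consistent_congr τ (fun t ht e _ => (h3.unique h1 (by omega)).1 e)
    (fun t ht e _ => (h3.unique h1 (by omega)).2 e)

theorem swap_swap : P.swap τ sel v (!j) (P.swap τ sel v j p) = p := by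
  have h := P.histories_swap hτ hv hp
  refine Prod.ext ?_ ?_
  · rw [swap, h]
    exact swapInput_swap _ _ _ _
  · rw [swap, h]
    exact swapTable_swap _ _ _ _

theorem result_swap :
    P.result (P.swap τ sel v j p).1 (P.attack τ sel (P.swap τ sel v j p).2 (!j)) v
      = P.result p.1 (P.attack τ sel p.2 j) v := by
  obtain ⟨h1, h2⟩ := (P.isAttacked τ sel p.2 p.1 j).swap hτ hv hp
  have h3 := P.isAttacked τ sel (P.swap τ sel v j p).2 (P.swap τ sel v j p).1 (!j)
  rw [result_eq, result_eq]
  have h4 : (P.swap τ sel v j p).1 v = p.1 v := if_pos rfl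
  rw [h4]
  congr 1
  funext t i
  simp only [view]
  rw [(h3.unique h1 t.2).2]
  simp [fakeDelivered, hv]

end Protocol

end Swap

/-! ### The two attacks cannot both be survived -/

section Confusion

open scoped Classical

variable {V : Type} [Fintype V] {Q : Digraph V} {R : ℕ} {Ω O : V → Type} [∀ a, Fintype (Ω a)]

/-- The probability of the table `σ`. -/
def tableWeight (m : ∀ a, Ω a → ℝ) (σ : Table Ω) : ℝ := ∏ i, condWeight (m i.1) i.2 (σ i)

/-- The probability of the inputs `x`. -/
def inputWeight (m : ∀ a, Ω a → ℝ) (x : ∀ a, Ω a) : ℝ := ∏ a, m a (x a)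

variable {m : ∀ a, Ω a → ℝ}

theorem inputWeight_mul_tableWeight (x : ∀ a, Ω a) (σ : Table Ω) :
    inputWeight m x * tableWeight m σ
      = ∏ a, (m a (x a) * ∏ K : Finset (Ω a), condWeight (m a) K (σ ⟨a, K⟩)) := by
  rw [inputWeight, tableWeight, Fintype.prod_sigma, Finset.prod_mul_distrib]

/-- For each `a ≠ v` only the input and the table entry at `K a` trade places, and
`mul_condWeight_comm` applies to this pair of factors. -/
theorem weight_swap (v : V) (K : ∀ a, Finset (Ω a)) (σ : Table Ω)
    (x : ∀ a, Ω a) (hx : ∀ a, x a ∈ K a) (hσ : ∀ a, σ ⟨a, K a⟩ ∈ K a) :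
    inputWeight m (Protocol.swapInput v K σ x) * tableWeight m (Protocol.swapTable v K σ x)
      = inputWeight m x * tableWeight m σ := by
  rw [inputWeight_mul_tableWeight, inputWeight_mul_tableWeight]
  refine Finset.prod_congr rfl fun a _ => ?_
  by_cases h : a = v
  · simp [Protocol.swapInput, Protocol.swapTable, h]
  · rw [← Finset.mul_prod_erase _ _ (Finset.mem_univ (K a)),
      ← Finset.mul_prod_erase _ (fun L => condWeight (m a) L (σ ⟨a, L⟩)) (Finset.mem_univ (K a)),
      ← mul_assoc, ← mul_assoc]
    congr 1
    · simp only [Protocol.swapInput, Protocol.swapTable, ne_eq, h, not_false_eq_true,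
        true_and, if_true]
      exact mul_condWeight_comm (hσ a) (hx a)
    · refine Finset.prod_congr rfl fun L hL => ?_
      simp [Protocol.swapTable, Finset.ne_of_mem_erase hL]

theorem sum_inputWeight_mul (h1 : ∀ a, ∑ b, m a b = 1) (u : V) (h : Ω u → ℝ) :
    ∑ x, inputWeight m x * h (x u) = ∑ b, m u b * h b :=
  sum_prod_mul_apply m h1 u h

theorem sum_tableWeight_mul (h1 : ∀ a, ∑ b, m a b = 1) (u : V)
    (K : Finset (Ω u)) (h : Ω u → ℝ) :
    ∑ σ, tableWeight m σ * h (σ ⟨u, K⟩) = ∑ b, condWeight (m u) K b * h b :=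
  sum_prod_mul_apply (β := fun i : (Σ a, Finset (Ω a)) => Ω i.1)
    (fun i => condWeight (m i.1) i.2) (fun i => sum_condWeight (h1 i.1) i.2) ⟨u, K⟩ h

omit [∀ a, Fintype (Ω a)] in
theorem inputWeight_nonneg (hm : ∀ a b, 0 ≤ m a b) (x : ∀ a, Ω a) : 0 ≤ inputWeight m x :=
  Finset.prod_nonneg fun a _ => hm a _

theorem tableWeight_nonneg (hm : ∀ a b, 0 ≤ m a b) (σ : Table Ω) : 0 ≤ tableWeight m σ :=
  Finset.prod_nonneg fun i _ => condWeight_nonneg (hm i.1) _ _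

theorem sum_inputWeight (h1 : ∀ a, ∑ b, m a b = 1) : ∑ x, inputWeight m x = 1 := by
  simp only [inputWeight]
  rw [← Fintype.prod_sum m]
  simp [h1]

theorem sum_tableWeight (h1 : ∀ a, ∑ b, m a b = 1) :
    ∑ σ, tableWeight m σ = 1 := by
  simp only [tableWeight]
  rw [← Fintype.prod_sum (fun i : (Σ a, Finset (Ω a)) => condWeight (m i.1) i.2)]
  simp [sum_condWeight (h1 _)]

namespace Protocol

variable (P : Protocol Q R Ω O) {τ : V → ℕ} {sel : ℕ → Bool} {u v : V} {r : ℕ}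

variable {X : Ω u → O v} {ε : ℝ}

/-- A union bound over the transcripts `y` of the first `r` rounds. Once `y` is fixed, the table
entry consulted for `u` is fixed too, hence independent of the inputs. -/
theorem sum_eq_le (hm : ∀ a b, 0 ≤ m a b) (h1 : ∀ a, ∑ b, m a b = 1) (hτ : ∀ a, τ a ≤ R)
    (hr : ∀ a, r ≤ τ a) (hu : τ u = r) (hε : 0 ≤ ε)
    (hX : ∀ z, ∑ b, m u b * (if X b = z then 1 else 0) ≤ ε) (j : Bool) :
    ∑ p : (∀ a, Ω a) × Table Ω, inputWeight m p.1 * tableWeight m p.2 *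
        (if X (p.2 ⟨u, P.histories τ sel j p u⟩) = X (p.1 u) then 1 else 0)
      ≤ 2 ^ (r * Nat.card (Edge Q)) * ε := by
  have hcard : (Fintype.card (Fin r → Edge Q → Bool) : ℝ) = 2 ^ (r * Nat.card (Edge Q)) := by
    simp [Nat.card_eq_fintype_card, pow_mul']
  let K : (Fin r → Edge Q → Bool) → Finset (Ω u) := fun y =>
    P.consistent τ (extend y) (extend y) u
  let g : (Fin r → Edge Q → Bool) → Ω u → Ω u → ℝ := fun y b b' =>
    (if b ∈ K y then 1 else 0) * (if X b' = X b then 1 else 0)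
  have hg : ∀ y b b', 0 ≤ g y b b' := fun y b b' => by
    dsimp only [g]
    positivity
  calc _ ≤ ∑ p : (∀ a, Ω a) × Table Ω, ∑ y, inputWeight m p.1 * tableWeight m p.2 *
        g y (p.1 u) (p.2 ⟨u, K y⟩) := by
        refine Finset.sum_le_sum fun p _ => ?_
        have hw : 0 ≤ inputWeight m p.1 * tableWeight m p.2 :=
          mul_nonneg (inputWeight_nonneg hm _) (tableWeight_nonneg hm _)
        obtain ⟨y, hy⟩ := P.exists_histories_eq (sel := sel) hr hu (hu ▸ hτ u) j p
        refine le_trans ?_ (Finset.single_le_sum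
          (fun y _ => mul_nonneg hw (hg y _ _)) (Finset.mem_univ y))
        have hmem : p.1 u ∈ K y := by
          dsimp only [K]
          rw [← hy]
          exact (P.isAttacked τ sel p.2 p.1 j).mem_consistent u (hτ u)
        have hK : P.histories τ sel j p u = K y := hy
        have hpK : p.2 ⟨u, P.histories τ sel j p u⟩ = p.2 ⟨u, K y⟩ := by rw [hK]
        rw [hpK]
        simp only [g, hmem, if_true, one_mul]
        exact le_rfl
    _ = ∑ y, ∑ x : ∀ a, Ω a, inputWeight m x * ∑ σ : Table Ω, tableWeight m σ *
        g y (x u) (σ ⟨u, K y⟩) := by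
        rw [Finset.sum_comm]
        refine Finset.sum_congr rfl fun y _ => ?_
        rw [Fintype.sum_prod_type]
        refine Finset.sum_congr rfl fun x _ => ?_
        rw [Finset.mul_sum]
        exact Finset.sum_congr rfl fun σ _ => by ring
    _ = ∑ y, ∑ b, m u b * ((if b ∈ K y then 1 else 0) *
        ∑ b', condWeight (m u) (K y) b' * (if X b' = X b then 1 else 0)) := by
        refine Finset.sum_congr rfl fun y _ => ?_
        rw [← sum_inputWeight_mul h1 u]
        refine Finset.sum_congr rfl fun x _ => ?_
        rw [sum_tableWeight_mul h1 u (K y) (g y (x u))]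
        congr 1
        rw [Finset.mul_sum]
        refine Finset.sum_congr rfl fun b _ => ?_
        dsimp only [g]
        ring
    _ ≤ ∑ y : Fin r → Edge Q → Bool, ε :=
        Finset.sum_le_sum fun y _ => sum_mul_sum_condWeight_le (hm u) X hε hX (K y)
    _ = _ := by
        rw [Finset.sum_const, Finset.card_univ, nsmul_eq_mul, hcard]

/-- When the inputs and the table are random, the failure probabilities of the two attacks
sum up to almost one. -/
theorem one_sub_le_sum (hm : ∀ a b, 0 ≤ m a b) (h1 : ∀ a, ∑ b, m a b = 1) (hτ : ∀ a, τ a ≤ R)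
    (hr : ∀ a, r ≤ τ a) (hu : τ u = r) (hv : τ v = R) (huv : u ≠ v) (hε : 0 ≤ ε)
    (hX : ∀ z, ∑ b, m u b * (if X b = z then 1 else 0) ≤ ε) :
    1 - 2 ^ (r * Nat.card (Edge Q)) * ε ≤
      ∑ σ, tableWeight m σ * ∑ x, inputWeight m x *
        (if P.result x (P.attack τ sel σ false) v ≠ X (x u) then 1 else 0) +
      ∑ σ, tableWeight m σ * ∑ x, inputWeight m x *
        (if P.result x (P.attack τ sel σ true) v ≠ X (x u) then 1 else 0) := by
  let W : (∀ a, Ω a) × Table Ω → ℝ := fun p => inputWeight m p.1 * tableWeight m p.2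
  let err : Bool → (∀ a, Ω a) × Table Ω → ℝ := fun j p =>
    if P.result p.1 (P.attack τ sel p.2 j) v ≠ X (p.1 u) then 1 else 0
  let eq : (∀ a, Ω a) × Table Ω → ℝ := fun p =>
    if X (p.2 ⟨u, P.histories τ sel false p u⟩) = X (p.1 u) then 1 else 0
  have hW : ∀ p, 0 ≤ W p := fun p =>
    mul_nonneg (inputWeight_nonneg hm _) (tableWeight_nonneg hm _)
  have herr : ∀ j p, 0 ≤ err j p := fun j p => by
    dsimp only [err]
    positivity
  have hsum : ∀ j, ∑ σ, tableWeight m σ * ∑ x, inputWeight m x *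
      (if P.result x (P.attack τ sel σ j) v ≠ X (x u) then 1 else 0) = ∑ p, W p * err j p := by
    intro j
    rw [Fintype.sum_prod_type_right]
    refine Finset.sum_congr rfl fun σ _ => ?_
    rw [Finset.mul_sum]
    exact Finset.sum_congr rfl fun x _ => by dsimp only [W, err]; ring
  rw [hsum, hsum]
  have hW1 : ∑ p, W p = 1 := by
    rw [Fintype.sum_prod_type]
    simp only [W, ← Finset.mul_sum, sum_tableWeight h1, mul_one, sum_inputWeight h1]
  have hmem : ∀ p a, p.1 a ∈ P.histories τ sel false p a := fun p a =>
    (P.isAttacked τ sel p.2 p.1 false).mem_consistent a (hτ a)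
  have hgood : ∀ p, W p ≠ 0 → ∀ a,
      p.2 ⟨a, P.histories τ sel false p a⟩ ∈ P.histories τ sel false p a := by
    intro p hp a
    have h2 := mul_ne_zero_iff.mp hp
    have h3 := (Finset.prod_ne_zero_iff.mp h2.1) a (Finset.mem_univ a)
    have h4 := (Finset.prod_ne_zero_iff.mp h2.2) ⟨a, P.histories τ sel false p a⟩
      (Finset.mem_univ _)
    exact mem_of_condWeight_ne_zero (hm a) (hmem p a) h3 h4
  -- Off the support the table may name an input inconsistent with the history, and the exchange
  -- need not be invertible.
  let Z : Finset ((∀ a, Ω a) × Table Ω) := Finset.univ.filter fun p => W p ≠ 0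
  have hZ : ∀ p ∈ Z, ∀ a,
      p.2 ⟨a, P.histories τ sel false p a⟩ ∈ P.histories τ sel false p a := fun p hp =>
    hgood p (Finset.mem_filter.mp hp).2
  have hZsum : ∀ h : (∀ a, Ω a) × Table Ω → ℝ, ∑ p ∈ Z, W p * h p = ∑ p, W p * h p := fun h =>
    Finset.sum_subset (Finset.subset_univ _) fun p _ hp => by
      have : W p = 0 := by simpa [Z] using hp
      rw [this, zero_mul]
  have htrue : ∑ p ∈ Z, W p * err true (P.swap τ sel v false p) ≤ ∑ p, W p * err true p := by
    have hinj : Set.InjOn (P.swap τ sel v false) Z := fun p hp q hq hpq => by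
      rw [← P.swap_swap hτ hv (hZ p hp), ← P.swap_swap hτ hv (hZ q hq), hpq]
    calc _ = ∑ p ∈ Z, W (P.swap τ sel v false p) * err true (P.swap τ sel v false p) :=
          Finset.sum_congr rfl fun p hp => by
            congr 1
            exact (weight_swap v _ p.2 p.1 (hmem p) (hZ p hp)).symm
      _ = ∑ q ∈ Z.image (P.swap τ sel v false), W q * err true q :=
          (Finset.sum_image (f := fun q => W q * err true q) hinj).symm
      _ ≤ _ := Finset.sum_le_sum_of_subset_of_nonneg (Finset.subset_univ _)
          fun q _ _ => mul_nonneg (hW q) (herr _ q)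
  have hpoint : ∀ p ∈ Z, 1 - eq p ≤ err false p + err true (P.swap τ sel v false p) := by
    intro p hp
    have h2 := P.result_swap hτ hv (hZ p hp)
    rw [Bool.not_false] at h2
    have h3 : (P.swap τ sel v false p).1 u = p.2 ⟨u, P.histories τ sel false p u⟩ := if_neg huv
    have key : ∀ a b b' : O v, (1 : ℝ) - (if b' = b then 1 else 0)
        ≤ (if a ≠ b then 1 else 0) + (if a ≠ b' then 1 else 0) := by
      intro a b b'
      by_cases hb : b' = b
      · rw [if_pos hb, sub_self]
        positivity
      · by_cases ha : a = b
        · have : a ≠ b' := fun h => hb (h.symm.trans ha)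
          simp [ha, hb, Ne.symm hb]
        · have : (0 : ℝ) ≤ if a ≠ b' then 1 else 0 := by positivity
          simpa [ha, hb] using this
    dsimp only [eq, err]
    rw [h2, h3]
    exact key _ _ _
  have heq := P.sum_eq_le (sel := sel) hm h1 hτ hr hu hε hX false
  calc _ ≤ 1 - ∑ p, W p * eq p := by linarith
    _ = ∑ p ∈ Z, W p * (1 - eq p) := by
        rw [hZsum]
        simp only [mul_sub, mul_one, Finset.sum_sub_distrib, hW1]
    _ ≤ ∑ p ∈ Z, W p * (err false p + err true (P.swap τ sel v false p)) :=
        Finset.sum_le_sum fun p hp => mul_le_mul_of_nonneg_left (hpoint p hp) (hW p)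
    _ = ∑ p, W p * err false p + ∑ p ∈ Z, W p * err true (P.swap τ sel v false p) := by
        rw [← hZsum (err false), ← Finset.sum_add_distrib]
        simp only [mul_add]
    _ ≤ _ := by linarith

/-- If for each table both attacks fail with probability at most `φ` on random inputs, then `φ` is
not much less than `1 / 2`. -/
theorem one_sub_le_two_mul (hm : ∀ a b, 0 ≤ m a b) (h1 : ∀ a, ∑ b, m a b = 1) (hτ : ∀ a, τ a ≤ R)
    (hr : ∀ a, r ≤ τ a) (hu : τ u = r) (hv : τ v = R) (huv : u ≠ v) (hε : 0 ≤ ε)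
    (hX : ∀ z, ∑ b, m u b * (if X b = z then 1 else 0) ≤ ε) {φ : ℝ}
    (hφ : ∀ σ j, ∑ x, inputWeight m x *
      (if P.result x (P.attack τ sel σ j) v ≠ X (x u) then 1 else 0) ≤ φ) :
    1 - 2 ^ (r * Nat.card (Edge Q)) * ε ≤ 2 * φ := by
  have hsum : ∀ j, ∑ σ, tableWeight m σ * ∑ x, inputWeight m x *
      (if P.result x (P.attack τ sel σ j) v ≠ X (x u) then 1 else 0) ≤ φ := fun j => by
    calc _ ≤ ∑ σ, tableWeight m σ * φ := Finset.sum_le_sum fun σ _ =>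
          mul_le_mul_of_nonneg_left (hφ σ j) (tableWeight_nonneg hm σ)
      _ = φ := by rw [← Finset.sum_mul, sum_tableWeight h1, one_mul]
  have := P.one_sub_le_sum (sel := sel) hm h1 hτ hr hu hv huv hε hX
  linarith [hsum false, hsum true]

end Protocol

end Confusion

/-! ### Distance layers from `u` -/

section Layers

variable {V : Type} {G : Digraph V}

theorem HasWalk.snoc {n : ℕ} {u a b : V} (h : HasWalk G n u a) (hab : G.Adj a b) :
    HasWalk G (n + 1) u b := by
  induction n generalizing u with
  | zero =>
    obtain rfl : u = a := h
    exact ⟨b, hab, rfl⟩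
  | succ n ih =>
    obtain ⟨w, hw, h⟩ := h
    exact ⟨w, hw, ih h⟩

theorem HasWalk.exists_path {n : ℕ} {u v : V} (h : HasWalk G n u v) :
    ∃ p : ℕ → V, p 0 = u ∧ p n = v ∧ ∀ i < n, G.Adj (p i) (p (i + 1)) := by
  induction n generalizing u with
  | zero => exact ⟨fun _ => u, rfl, h, by omega⟩
  | succ n ih =>
    obtain ⟨w, hw, h⟩ := h
    obtain ⟨p, h0, hn, hp⟩ := ih h
    refine ⟨fun i => if i = 0 then u else p (i - 1), by simp, by simpa using hn, fun i hi => ?_⟩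
    rcases i with _ | i
    · simpa [h0] using hw
    · simpa using hp i (by omega)

variable (G) in
/-- The distance from `u` to `w`, or `D` if that is smaller. -/
def layer (u : V) (D : ℕ) (w : V) : ℕ := sInf {n | n = D ∨ HasWalk G n u w}

theorem layer_spec (u : V) (D : ℕ) (w : V) :
    layer G u D w = D ∨ HasWalk G (layer G u D w) u w :=
  Nat.sInf_mem (s := {n | n = D ∨ HasWalk G n u w}) ⟨D, Or.inl rfl⟩

theorem layer_le (u : V) (D : ℕ) (w : V) : layer G u D w ≤ D := Nat.sInf_le (Or.inl rfl)

theorem layer_le_of_hasWalk {u : V} {D n : ℕ} {w : V} (h : HasWalk G n u w) :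
    layer G u D w ≤ n := Nat.sInf_le (Or.inr h)

theorem layer_self (u : V) (D : ℕ) : layer G u D u = 0 :=
  Nat.le_zero.mp (layer_le_of_hasWalk rfl)

theorem layer_le_succ {u : V} {D : ℕ} {a b : V} (h : G.Adj a b) :
    layer G u D b ≤ layer G u D a + 1 := by
  rcases layer_spec (G := G) u D a with ha | ha
  · have := layer_le (G := G) u D b
    omega
  · exact layer_le_of_hasWalk (ha.snoc h)

theorem IsDist.layer_eq {u v : V} {D : ℕ} (h : IsDist G u v D) : layer G u D v = D := by
  rcases layer_spec (G := G) u D v with hv | hv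
  · exact hv
  · exact le_antisymm (layer_le u D v) (h.2 hv)

theorem layer_path {u : V} {D : ℕ} {p : ℕ → V} (h0 : p 0 = u) (hD : layer G u D (p D) = D)
    (hp : ∀ i < D, G.Adj (p i) (p (i + 1))) {i : ℕ} (hi : i ≤ D) : layer G u D (p i) = i := by
  have h1 : ∀ i ≤ D, layer G u D (p i) ≤ i := by
    intro i
    induction i with
    | zero => simp [h0, layer_self]
    | succ i ih =>
      intro hi
      have := ih (by omega)
      have := layer_le_succ (u := u) (D := D) (hp i (by omega))
      omega
  have h2 : ∀ k ≤ D, D - k ≤ layer G u D (p (D - k)) := by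
    intro k
    induction k with
    | zero => simp [hD]
    | succ k ih =>
      intro hk
      have := ih (by omega)
      have h3 := layer_le_succ (u := u) (D := D) (hp (D - (k + 1)) (by omega))
      rw [show D - (k + 1) + 1 = D - k by omega] at h3
      omega
  have h3 := h2 (D - i) (by omega)
  rw [show D - (D - i) = i by omega] at h3
  exact le_antisymm (h1 i hi) h3

end Layers

/-! ### The protocol that is hard to simulate -/

section Relay

open scoped Classical

variable {V : Type}

/-- The protocol in which `u` sends its input bit by bit, each party `w` forwards the bits that it
receives from `p (l w - 1)`, and the output consists of the bits received from `p (D - 1)`. -/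
def relay (G : Digraph V) (T D k : ℕ) (u : V) (l : V → ℕ) (p : ℕ → V) :
    Protocol G T (fun _ => Fin k → Bool) (fun _ => Fin k → Bool) where
  send w x t received _ :=
    if w = u then (if h : (t : ℕ) < k then x ⟨t, h⟩ else false)
    else if h : 0 < (t : ℕ) ∧ G.Adj (p (l w - 1)) w then
      received ⟨t - 1, by omega⟩ ⟨p (l w - 1), h.2⟩
    else false
  output w _ received i :=
    if h : i + (D - 1) < T ∧ G.Adj (p (D - 1)) w then
      received ⟨i + (D - 1), h.1⟩ ⟨p (D - 1), h.2⟩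
    else false

/-- Pipelining: bit `t` leaves `u` in round `t` and advances one edge of the path per round. -/
theorem relay_delivered {G : Digraph V} {T D k : ℕ} {u : V} {l : V → ℕ} {p : ℕ → V}
    (h0 : p 0 = u) (hp : ∀ i < D, G.Adj (p i) (p (i + 1))) (hl : ∀ i ≤ D, l (p i) = i)
    (x : V → Fin k → Bool) {i : ℕ} (hi : i < D) (t : Fin k) (ht : t + i < T) :
    (relay G T D k u l p).deliveredTrace x (noiseless G T) (t + i) ⟨(p i, p (i + 1)), hp i hi⟩
      = x u t := by
  induction i with
  | zero =>
    rw [Protocol.deliveredTrace_eq _ _ _ ht]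
    simp only [noiseless, Fin.val_last]
    rw [Protocol.sentTrace_eq_bit _ _ _ ht, Protocol.bit, dif_pos ht]
    subst h0
    simp [relay]
  | succ i ih =>
    rw [Protocol.deliveredTrace_eq _ _ _ ht]
    simp only [noiseless, Fin.val_last]
    rw [Protocol.sentTrace_eq_bit _ _ _ ht, Protocol.bit, dif_pos ht]
    have hne : p (i + 1) ≠ u := fun h => by
      have h1 := hl (i + 1) hi.le
      have h2 := hl 0 (Nat.zero_le _)
      rw [h0] at h2
      rw [h] at h1
      omega
    have hl' : l (p (i + 1)) - 1 = i := by rw [hl (i + 1) hi.le]; rfl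
    have hpos : 0 < t + (i + 1) ∧ G.Adj (p (l (p (i + 1)) - 1)) (p (i + 1)) :=
      ⟨by omega, by rw [hl']; exact hp i (by omega)⟩
    simp only [relay, if_neg hne]
    rw [dif_pos hpos, ← ih (by omega) (by omega)]
    simp only [Protocol.view, hl']
    rfl

theorem relay_result {G : Digraph V} {T D k : ℕ} {u : V} {l : V → ℕ} {p : ℕ → V}
    (h0 : p 0 = u) (hp : ∀ i < D, G.Adj (p i) (p (i + 1))) (hl : ∀ i ≤ D, l (p i) = i)
    (hD : 1 ≤ D) (hT : k + D ≤ T) (x : V → Fin k → Bool) :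
    (relay G T D k u l p).result x (noiseless G T) (p D) = x u := by
  obtain ⟨d, rfl⟩ : ∃ d, D = d + 1 := ⟨D - 1, by omega⟩
  rw [Protocol.result_eq]
  funext t
  rw [← relay_delivered (T := T) h0 hp hl x (i := d) (by omega) t (by omega)]
  simp only [relay]
  have hc : (t : ℕ) + (d + 1 - 1) < T ∧ G.Adj (p (d + 1 - 1)) (p (d + 1)) :=
    ⟨by omega, hp d (by omega)⟩
  rw [dif_pos hc]
  rfl

end Relay

/-! ### The error rate of the attack -/

section Rate

open scoped Classical

variable {V : Type} {Q : Digraph V} {R : ℕ} {Ω O Ω' O' : V → Type} [∀ a, Fintype (Ω a)]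

/-- The attack is computed from `P` but may face any `P'`: the adversary models the parties by
strategies, while the rate is measured on the simulation with its coins. -/
theorem Protocol.flips_attack_le (P : Protocol Q R Ω O) (P' : Protocol Q R Ω' O')
    (x : ∀ a, Ω' a) (l : V → ℕ) (hl : ∀ a b, Q.Adj a b → l b ≤ l a + 1) (r f : ℕ) (σ : Table Ω)
    (j : Bool) (e : Edge Q) :
    P'.flips x (P.attack (fun a => r + 2 * f * l a)
      (fun t => decide (f ≤ (t - r) % (2 * f))) σ j) e ≤ f := by
  set τ : V → ℕ := fun a => r + 2 * f * l a
  set sel : ℕ → Bool := fun t => decide (f ≤ (t - r) % (2 * f))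
  set N := P.attack τ sel σ j
  set c := if j then τ e.1.1 else τ e.1.1 + f
  have hle : τ e.1.2 ≤ τ e.1.1 + 2 * f := by
    have := Nat.mul_le_mul_left (2 * f) (hl _ _ e.2)
    simp only [τ]
    linarith
  calc _ ≤ (Finset.Ico c (c + f)).card := by
        refine Finset.card_le_card_of_injOn Fin.val (fun t ht => ?_) Fin.val_injective.injOn
        have ht' : P'.sent x N t e ≠ P'.delivered x N t e := by simpa using ht
        have h1 : P'.sentTrace x N t e ≠ P'.deliveredTrace x N t e := by
          rwa [sentTrace, deliveredTrace, extend_of_lt _ t.2, extend_of_lt _ t.2]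
        rw [(P'.deliveredTrace_eq x N t.2 e).trans (P.attack_apply τ sel σ j _ _ t.2 e)] at h1
        have h2 : τ e.1.1 ≤ t ∧ t < τ e.1.2 ∧ sel t ≠ j := by
          by_contra h
          rw [if_neg h] at h1
          exact h1 rfl
        obtain ⟨h2, h3, h4⟩ := h2
        obtain ⟨q, hq⟩ := Nat.exists_eq_add_of_le h2
        have hmod : (t - r) % (2 * f) = q := by
          rw [hq, show τ e.1.1 + q - r = q + 2 * f * l e.1.1 by simp only [τ]; omega,
            Nat.add_mul_mod_self_left, Nat.mod_eq_of_lt (by omega)]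
        simp only [Finset.coe_Ico, Set.mem_Ico]
        have h5 : sel t = decide (f ≤ q) := by rw [← hmod]
        rw [h5] at h4
        cases j <;> simp [c] at h4 ⊢ <;> omega
    _ = f := by simp

end Rate

/-! ### From private coins to finitely many strategies -/

section Strategies

open scoped Classical

variable {V : Type} [Fintype V] {Q : Digraph V} {R : ℕ} {I O : V → Type}

/-- The deterministic behaviours of the party `a`. -/
structure Strategy (Q : Digraph V) (R : ℕ) (O : V → Type) (a : V) : Type where
  send : ∀ t : Fin R, (Fin t → InNbr Q a → Bool) → OutNbr Q a → Bool
  output : (Fin R → InNbr Q a → Bool) → O a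

instance (a : V) [Finite (O a)] : Finite (Strategy Q R O a) :=
  Finite.of_injective (fun f => (f.send, f.output)) fun f g h => by
    cases f; cases g; simpa using h

instance (a : V) [Finite (O a)] : Fintype (Strategy Q R O a) := Fintype.ofFinite _

instance (a : V) : MeasurableSpace (Strategy Q R O a) := ⊤

instance (a : V) : MeasurableSingletonClass (Strategy Q R O a) := ⟨fun _ => trivial⟩

variable (Q R I O) in
/-- The protocol in which each party follows its strategy. -/
def follow : Protocol Q R (fun a => I a × Strategy Q R O a) O where
  send _ x := x.2.send
  output _ x := x.2.output

omit [Fintype V] in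
theorem Protocol.result_follow {I' : V → Type} (P : Protocol Q R I' O) (x : ∀ a, I' a)
    (y : ∀ a, I a × Strategy Q R O a) (h : ∀ a, (y a).2 = ⟨P.send a (x a), P.output a (x a)⟩)
    (N : Channel Q R) (v : V) : (follow Q R I O).result y N v = P.result x N v := by
  have hsend : ∀ a, (follow Q R I O).send a (y a) = P.send a (x a) := fun a =>
    congrArg Strategy.send (h a)
  have houtput : ∀ a, (follow Q R I O).output a (y a) = P.output a (x a) := fun a =>
    congrArg Strategy.output (h a)
  have hexec : ∀ t (ht : t ≤ R), (follow Q R I O).exec y N t ht = P.exec x N t ht := by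
    intro t
    induction t with
    | zero => exact fun _ => rfl
    | succ t ih =>
      intro ht
      simp only [exec, ih, hsend]
  simp only [result, delivered, hexec, houtput]

variable {G : Digraph V} (S : Simulation G I O)

/-- The strategy of `a` in the simulation, with input `x` and private randomness `c`. -/
def Simulation.strategy (a : V) (x : I a) (c : S.Coin a) : Strategy S.graph S.rounds O a :=
  ⟨S.protocol.send a (x, c), S.protocol.output a (x, c)⟩

theorem Simulation.measurable_strategy (a : V) [Finite (O a)] (x : I a) :
    Measurable (S.strategy a x) := by
  refine measurable_to_countable' fun f => ?_
  have : S.strategy a x ⁻¹' {f}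
      = (⋂ t, ⋂ b, ⋂ w, {c | S.protocol.send a (x, c) t b w = f.send t b w}) ∩
        ⋂ b, {c | S.protocol.output a (x, c) b = f.output b} := by
    ext c
    cases f
    simp [strategy, funext_iff]
  rw [this]
  refine MeasurableSet.inter ?_ (MeasurableSet.iInter fun b => S.measurable_output a x b _)
  exact MeasurableSet.iInter fun t => MeasurableSet.iInter fun b => MeasurableSet.iInter fun w =>
    S.measurable_send a x t b w (measurableSet_singleton _)

/-- The law of the strategy of `a` in the simulation, on input `x`. -/
def Simulation.strategyLaw (a : V) (x : I a) : Measure (Strategy S.graph S.rounds O a) :=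
  (S.coinLaw a).map (S.strategy a x)

variable [∀ a, Finite (O a)]

instance (a : V) (x : I a) : IsProbabilityMeasure (S.strategyLaw a x) :=
  Measure.isProbabilityMeasure_map (S.measurable_strategy a x).aemeasurable

/-- An error at `v` alone is already a failure, and independent coins push forward to independent
strategies. -/
theorem Simulation.sum_strategyLaw_le_failure {T : ℕ} (P : Protocol G T I O) (A : S.Adversary)
    (x : ∀ a, I a) (v : V) :
    ∑ f : ∀ a, Strategy S.graph S.rounds O a, (∏ a, (S.strategyLaw a (x a)).real {f a}) *
        (if (follow S.graph S.rounds I O).result (fun a => (x a, f a)) (A x) v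
          ≠ P.result x (noiseless G T) v then 1 else 0)
      ≤ (S.failure P A x).toReal := by
  set B : Set (∀ a, Strategy S.graph S.rounds O a) :=
    {f | (follow S.graph S.rounds I O).result (fun a => (x a, f a)) (A x) v
          ≠ P.result x (noiseless G T) v}
  have h1 : (Measure.pi fun a => S.strategyLaw a (x a)).real B ≤ (S.failure P A x).toReal := by
    refine ENNReal.toReal_mono (measure_ne_top _ _) ?_
    have hB : MeasurableSet B := B.toFinite.measurableSet
    have hmeas : Measurable fun (c : ∀ a, S.Coin a) a => S.strategy a (x a) (c a) :=
      measurable_pi_lambda _ fun a => (S.measurable_strategy a (x a)).comp (measurable_pi_apply a)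
    simp only [strategyLaw]
    rw [← Measure.pi_map_pi fun a => (S.measurable_strategy a (x a)).aemeasurable,
      Measure.map_apply hmeas hB]
    refine measure_mono fun c hc => ⟨v, ?_⟩
    have h2 := S.protocol.result_follow (fun a => (x a, c a))
      (fun a => (x a, S.strategy a (x a) (c a))) (fun a => rfl) (A x) v
    rw [← h2]
    exact hc
  refine le_trans (le_of_eq ?_) h1
  have h3 : (Measure.pi fun a => S.strategyLaw a (x a)).real B
      = ∑ f ∈ Finset.univ.filter (· ∈ B), (Measure.pi fun a => S.strategyLaw a (x a)).real {f} := by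
    rw [sum_measureReal_singleton]
    simp
  rw [h3, Finset.sum_filter]
  refine Finset.sum_congr rfl fun f _ => ?_
  rw [mul_ite, mul_one, mul_zero]
  refine if_congr Iff.rfl ?_ rfl
  rw [Measure.real, Measure.pi_singleton, ENNReal.toReal_prod]
  rfl

/-- The probability that `a` has the given input and strategy, when its input is random. -/
def Simulation.strategyWeight [∀ a, Fintype (I a)] (a : V)
    (b : I a × Strategy S.graph S.rounds O a) : ℝ :=
  (Fintype.card (I a) : ℝ)⁻¹ * (S.strategyLaw a b.1).real {b.2}

section

variable [∀ a, Fintype (I a)]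

omit [Fintype V] [∀ a, Finite (O a)] in
theorem Simulation.strategyWeight_nonneg (a : V) (b : I a × Strategy S.graph S.rounds O a) :
    0 ≤ S.strategyWeight a b := by
  unfold strategyWeight
  positivity

theorem Simulation.sum_strategyWeight_mul (a : V) (h : I a → ℝ) :
    ∑ b, S.strategyWeight a b * h b.1 = (Fintype.card (I a) : ℝ)⁻¹ * ∑ x, h x := by
  rw [Fintype.sum_prod_type, Finset.mul_sum]
  refine Finset.sum_congr rfl fun x _ => ?_
  simp only [strategyWeight]
  rw [← Finset.sum_mul, ← Finset.mul_sum, sum_measureReal_singleton]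
  simp

theorem Simulation.sum_strategyWeight [∀ a, Nonempty (I a)] (a : V) :
    ∑ b, S.strategyWeight a b = 1 := by
  have := S.sum_strategyWeight_mul a fun _ => 1
  simpa using this

theorem Simulation.sum_inputWeight_mul_le [∀ a, Nonempty (I a)] {T : ℕ} (P : Protocol G T I O)
    (N : Channel S.graph S.rounds) (v : V) {φ : ℝ}
    (hφ : ∀ x, (S.failure P (fun _ => N) x).toReal ≤ φ) :
    ∑ y, inputWeight S.strategyWeight y *
        (if (follow S.graph S.rounds I O).result y N v
          ≠ P.result (fun a => (y a).1) (noiseless G T) v then 1 else 0) ≤ φ := by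
  rw [← (Equiv.arrowProdEquivProdArrow V I (Strategy S.graph S.rounds O)).symm.sum_comp,
    Fintype.sum_prod_type]
  have h1 : ∀ x, ∑ f : ∀ a, Strategy S.graph S.rounds O a,
      inputWeight S.strategyWeight (fun a => (x a, f a)) *
        (if (follow S.graph S.rounds I O).result (fun a => (x a, f a)) N v
          ≠ P.result x (noiseless G T) v then 1 else 0)
      ≤ (∏ a, (Fintype.card (I a) : ℝ)⁻¹) * φ := fun x => by
    refine le_trans (le_of_eq ?_) (mul_le_mul_of_nonneg_left
      ((S.sum_strategyLaw_le_failure P (fun _ => N) x v).trans (hφ x)) (by positivity))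
    rw [Finset.mul_sum]
    refine Finset.sum_congr rfl fun f _ => ?_
    simp only [inputWeight, strategyWeight, Finset.prod_mul_distrib]
    ring
  refine (Finset.sum_le_sum fun x _ => h1 x).trans (le_of_eq ?_)
  rw [Finset.sum_const, Finset.card_univ, nsmul_eq_mul, Fintype.card_pi, Nat.cast_prod,
    ← mul_assoc, ← Finset.prod_mul_distrib, Finset.prod_eq_one, one_mul]
  exact fun a _ => mul_inv_cancel₀ (by simp)

end

end Strategies

/-! ### The lower bound on the failure probability -/

section LowerBound

open scoped Classical

variable {V : Type} [Fintype V] {G : Digraph V}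

/-- If `v` has to learn `X` of the input of a vertex `u` at distance `D`, and for random inputs `X`
takes each value with probability at most `ε`, then a simulation fails with probability almost
`1 / 2`. -/
theorem Simulation.one_sub_le_two_mul_failureProbability {I O : V → Type} [∀ a, Fintype (I a)]
    [∀ a, Nonempty (I a)] [∀ a, Finite (O a)] {T D : ℕ} {u v : V} (hD : 1 ≤ D)
    (huv : IsDist G u v D) (S : Simulation G I O) (P : Protocol G T I O) (X : I u → O v)
    (hP : ∀ x, P.result x (noiseless G T) v = X (x u)) {ε : ℝ} (hε : 0 ≤ ε)
    (hX : ∀ z, (Fintype.card (I u) : ℝ)⁻¹ * ∑ x, (if X x = z then 1 else 0) ≤ ε)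
    (hfin : S.failureProbability P (1 / (2 * (D : ℝ))) ≠ ⊤) :
    1 - 2 ^ (S.rounds % (2 * D) * Nat.card (Edge S.graph)) * ε
      ≤ 2 * (S.failureProbability P (1 / (2 * (D : ℝ)))).toReal := by
  set f := S.rounds / (2 * D)
  set r := S.rounds % (2 * D)
  have hrf : r + 2 * f * D = S.rounds := by
    rw [← Nat.mod_add_div S.rounds (2 * D)]
    ring
  set τ : V → ℕ := fun a => r + 2 * f * layer G u D a with hτ_def
  set sel : ℕ → Bool := fun t => decide (f ≤ (t - r) % (2 * f))
  set F := follow S.graph S.rounds I O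
  have hrate : ∀ σ j, Adversary.WithinRate (S := S) (fun _ => F.attack τ sel σ j)
      (1 / (2 * (D : ℝ))) := by
    intro σ j x c e
    have h1 : S.protocol.flips (fun v => (x v, c v)) (F.attack τ sel σ j) e ≤ f :=
      F.flips_attack_le S.protocol _ _ (fun a b hab => layer_le_succ (S.graph_le hab)) r f σ j e
    have h2 : (f : ℝ) * (2 * D) ≤ S.rounds := by
      have : f * (2 * D) ≤ S.rounds := Nat.div_mul_le_self S.rounds (2 * D)
      exact_mod_cast this
    have hD' : (0 : ℝ) < 2 * D := by
      have : (1 : ℝ) ≤ D := by exact_mod_cast hD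
      linarith
    rw [one_div_mul_eq_div, le_div_iff₀ hD']
    refine le_trans (mul_le_mul_of_nonneg_right ?_ hD'.le) h2
    exact_mod_cast h1
  set Φ := S.failureProbability P (1 / (2 * (D : ℝ)))
  have hfail : ∀ σ j x, (S.failure P (fun _ => F.attack τ sel σ j) x).toReal ≤ Φ.toReal := by
    intro σ j x
    refine ENNReal.toReal_mono hfin ?_
    exact le_iSup_of_le (fun _ => F.attack τ sel σ j)
      (le_iSup_of_le (hrate σ j) (le_iSup (S.failure P fun _ => F.attack τ sel σ j) x))
  have hne : u ≠ v := by
    rintro rfl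
    have h0 : D ≤ 0 := huv.2 (show HasWalk G 0 u u from rfl)
    omega
  refine F.one_sub_le_two_mul (m := S.strategyWeight) (τ := τ) (sel := sel) (u := u) (v := v)
    (r := r) (X := fun b => X b.1) (ε := ε) S.strategyWeight_nonneg S.sum_strategyWeight
    (fun a => by
      have := Nat.mul_le_mul_left (2 * f) (layer_le (G := G) u D a)
      simp only [hτ_def]
      omega)
    (fun a => Nat.le_add_right _ _) (by simp [hτ_def, layer_self])
    (by simp only [hτ_def, huv.layer_eq]; exact hrf) hne hε
    (fun z => by
      rw [S.sum_strategyWeight_mul u fun x => if X x = z then 1 else 0]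
      exact hX z)
    (fun σ j => ?_)
  have := S.sum_inputWeight_mul_le P (F.attack τ sel σ j) v (hfail σ j)
  simpa only [hP] using this

/-- A simulation of a protocol in which `v` has to learn the `k`-bit input of a vertex `u` at
distance `D`, where `k` is large, fails with probability at least `1 / 4`. -/
theorem Simulation.one_fourth_le_failureProbability {T D k : ℕ} {u v : V} (hD : 1 ≤ D)
    (huv : IsDist G u v D) (hk : 2 * D * Fintype.card V ^ 2 + 1 ≤ k)
    (S : Simulation G (fun _ => Fin k → Bool) (fun _ => Fin k → Bool))
    (P : Protocol G T (fun _ => Fin k → Bool) (fun _ => Fin k → Bool))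
    (hP : ∀ x, P.result x (noiseless G T) v = x u) :
    1 / 4 ≤ S.failureProbability P (1 / (2 * (D : ℝ))) := by
  by_contra hlt
  rw [not_le] at hlt
  have hΦ : (S.failureProbability P (1 / (2 * (D : ℝ)))).toReal < 1 / 4 := by
    have := (ENNReal.toReal_lt_toReal hlt.ne_top (by norm_num)).mpr hlt
    simpa using this
  have hmain := S.one_sub_le_two_mul_failureProbability hD huv P id hP (ε := (2 ^ k)⁻¹)
    (by positivity) (fun z => by
      refine ((congrArg ((Fintype.card (Fin k → Bool) : ℝ)⁻¹ * ·)
        (Fintype.sum_eq_single z fun x hx => if_neg hx)).trans ?_).le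
      simp) hlt.ne_top
  have hpow : (2 : ℝ) ^ (S.rounds % (2 * D) * Nat.card (Edge S.graph)) * (2 ^ k)⁻¹ ≤ 1 / 2 := by
    have hE : Nat.card (Edge S.graph) ≤ Fintype.card V ^ 2 := by
      rw [Nat.card_eq_fintype_card, sq, ← Fintype.card_prod]
      exact Fintype.card_subtype_le _
    have hr : S.rounds % (2 * D) < 2 * D := Nat.mod_lt _ (by omega)
    -- The extra bit bounds the chance of agreement by `1 / 2`, which leaves `1 / 2 ≤ 2 * φ` for the
    -- failure probability `φ`. The bound on `k` does not involve the number of rounds, so the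
    -- compiler may choose that freely.
    have hle : S.rounds % (2 * D) * Nat.card (Edge S.graph) + 1 ≤ k :=
      le_trans (Nat.succ_le_succ (Nat.mul_le_mul hr.le hE)) hk
    rw [mul_inv_le_iff₀ (by positivity)]
    have := pow_le_pow_right₀ (one_le_two (α := ℝ)) hle
    rw [pow_succ] at this
    linarith
  linarith

end LowerBound

end SyncNet

end

theorem mainTheorem5 (C : SyncNet.Compiler) {V : Type} [Fintype V] (G : Digraph V) (D : ℕ)
    (hD : SyncNet.IsSignalDiameter G D) (hD_pos : 1 ≤ D) :
    ∀ᶠ T : ℕ in atTop, ∃ (I O : V → Type) (P : SyncNet.Protocol G T I O),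
      1 / 4 ≤ (C G T I O P).failureProbability P (1 / (2 * (D : ℝ))) := by
  obtain ⟨u, v, huv⟩ := hD.1
  obtain ⟨p, h0, rfl, hp⟩ := SyncNet.HasWalk.exists_path huv.1
  let k := 2 * D * Fintype.card V ^ 2 + 1
  filter_upwards [eventually_ge_atTop (k + D)] with T hT
  let P := SyncNet.relay G T D k u (SyncNet.layer G u D) p
  exact ⟨_, _, P, SyncNet.Simulation.one_fourth_le_failureProbability hD_pos huv le_rfl _ P
    fun x => SyncNet.relay_result h0 hp
      (fun i hi => SyncNet.layer_path h0 huv.layer_eq hp hi) hD_pos hT x⟩
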